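/- **Setting.** Let $\Gamma$ be an infinite connected graph without loops or multiple edges, with symmetric weights $\mu_{x,y}=\mu_{y,x}>0$ on the edges $x\sim y$, and let $\mu(x)=\sum_{y\sim x}\mu_{x,y}<\infty$. Let $(X_n)$ be the random walk with transition probabilities $P(x,y)=\mu_{x,y}/\mu(x)$, let $\mathbb P_x$ be its law started at $X_0=x$ and $\mathbb E_x$ the expectation, and put $$p_n(x,y)=\frac{\mathbb P_x(X_n=y)}{\mu(y)},\qquad \tilde p_n(x,y)=p_n(x,y)+p_{n+1}(x,y).$$ Let $d(x,y)$ be the graph distance, $B(x,R)=\{y: d(x,y)<R\}$, $V(x,R)=\sum_{y\in B(x,R)}\mu(y)$, and for $A\subset\Gamma$ let $\partial A$ be the set of vertices outside $A$ that have a neighbour in $A$. Let $T_A=\inf\{n\ge 0: X_n\notin A\}$ and $\tau_x=\inf\{n\ge 0:X_n=x\}$. Put $E_y(x,R)=\mathbb E_y\,T_{B(x,R)}$ and $E(x,R)=E_x(x,R)$ (so $E(x,0)=0$), and for integers $n\ge 0$ $$e(x,n)=\min\{r\in\{1,2,\dots\}: E(x,r)\ge n\}.$$ Let $\pi_{x,y}$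 be the set of all vertices lying on some shortest path from $x$ to $y$. For a constant $Q>0$, real $t\ge 0$ and an integer $R\ge 0$, let $l_9(x,y,t,R)$ be the least integer $l\ge 1$ such that $$\frac{t}{l}\ \ge\ Q\max_{z\in\pi_{x,y}}E\Big(z,\frac{9R}{l}\Big),$$ and let $l_9(x,y,t,R)=R$ if there is no such $l$. **Theorem.** Assume that * $(p_0)$: there is $p_0>0$ with $P(x,y)\ge p_0$ for all $x\sim y$; * $\Gamma$ is very strongly recurrent: there is $c_0>0$ such that $\mathbb P_w\big(\tau_x<T_{B(x,2r)}\big)\ge c_0$ for all $x\in\Gamma$, all integers $r\ge 1$ and all $w\in\partial B(x,r)$; * $(\overline E)$: there is $C_0>0$ such that $\max_{y\in B(x,R)}E_y(x,R)\le C_0E(x,R)$ for all $x\in\Gamma$ and all real $R>0$. Then there is $Q_0>0$ such that for every choice of the constant $Q\ge Q_0$ in the definition of $l_9$ there are $c,C>0$ such that for all $x,y\in\Gamma$ and all integers $n\ge d=d(x,y)$ $$\tilde p_n(x,y)\ \ge\ \frac{c}{V(x,e(x,n))}\exp\Big(-C\,l_9\big(x,y,\tfrac n2,d\big)\Big).$$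 -/

import Mathlib

open MeasureTheory ProbabilityTheory
open scoped ENNReal

noncomputable section

/-- A weighted graph on the vertex set `V`: a connected simple graph with symmetric weights which
are positive on the edges and zero elsewhere, the total weight at every vertex being finite. -/
structure WeightedGraph (V : Type*) where
  graph : SimpleGraph V
  weight : V → V → ℝ
  connected : graph.Connected
  weight_symm : ∀ x y, weight x y = weight y x
  weight_pos : ∀ x y, graph.Adj x y → 0 < weight x y
  weight_zero : ∀ x y, ¬ graph.Adj x y → weight x y = 0
  weight_summable : ∀ x, Summable (weight x)

namespace WeightedGraph

variable {V : Type*}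

/-- The measure `μ(x) = ∑_{y ∼ x} μ_{x,y}` of a vertex. -/
def mass (Γ : WeightedGraph V) (x : V) : ℝ := ∑' y, Γ.weight x y

/-- The one-step transition probability `P(x,y) = μ_{x,y} / μ(x)`. -/
def trans (Γ : WeightedGraph V) (x y : V) : ℝ := Γ.weight x y / Γ.mass x

theorem weight_nonneg (Γ : WeightedGraph V) (x y : V) : 0 ≤ Γ.weight x y := by
  by_cases h : Γ.graph.Adj x y
  · exact (Γ.weight_pos x y h).le
  · exact (Γ.weight_zero x y h).ge

theorem mass_pos [Infinite V] (Γ : WeightedGraph V) (x : V) : 0 < Γ.mass x := by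
  obtain ⟨y, hy⟩ := Γ.connected.preconnected.exists_adj_of_nontrivial x
  exact (Γ.weight_summable x).tsum_pos (Γ.weight_nonneg x) y (Γ.weight_pos x y hy)

theorem hasSum_trans [Infinite V] (Γ : WeightedGraph V) (x : V) :
    HasSum (fun y => ENNReal.ofReal (Γ.trans x y)) 1 := by
  have h : HasSum (Γ.trans x) 1 := by
    have := (Γ.weight_summable x).hasSum.div_const (Γ.mass x)
    rwa [← mass, div_self (Γ.mass_pos x).ne'] at this
  have hn : ∀ y, 0 ≤ Γ.trans x y := fun y => div_nonneg (Γ.weight_nonneg x y) (Γ.mass_pos x).le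
  have h2 := ENNReal.ofReal_tsum_of_nonneg hn h.summable
  rw [h.tsum_eq, ENNReal.ofReal_one] at h2
  rw [h2]
  exact ENNReal.summable.hasSum

/-- The law `P(x,·)` of one step of the random walk from `x`. -/
def step [Infinite V] (Γ : WeightedGraph V) (x : V) : PMF V :=
  ⟨fun y => ENNReal.ofReal (Γ.trans x y), Γ.hasSum_trans x⟩

/-- The transition kernel giving the law of `X_{n+1}` from the history `X_0, …, X_n`:
it is `P(X_n, ·)`. -/
def stepKernel [Infinite V] [MeasurableSpace V] [DiscreteMeasurableSpace V]
    (Γ : WeightedGraph V) (n : ℕ) : Kernel (Finset.Iic n → V) V where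
  toFun h := (Γ.step (h ⟨n, Finset.mem_Iic.2 le_rfl⟩)).toMeasure
  measurable' := by
    have h : Measurable (fun x : V => (Γ.step x).toMeasure) := Measurable.of_discrete
    exact h.comp (measurable_pi_apply _)

instance [Infinite V] [MeasurableSpace V] [DiscreteMeasurableSpace V]
    (Γ : WeightedGraph V) (n : ℕ) : IsMarkovKernel (Γ.stepKernel n) :=
  ⟨fun _ => PMF.toMeasure.isProbabilityMeasure _⟩

/-- The law `ℙ_x` on the path space of the random walk `(X_n)` started at `X_0 = x`;
`X_n` is the `n`-th coordinate. -/
def walk [Infinite V] [MeasurableSpace V] [DiscreteMeasurableSpace V]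
    (Γ : WeightedGraph V) (x : V) : Measure (ℕ → V) :=
  Kernel.traj (X := fun _ => V) Γ.stepKernel 0 (fun _ => x)

/-- The heat kernel `p_n(x,y) = ℙ_x(X_n = y) / μ(y)`. -/
def heat [Infinite V] [MeasurableSpace V] [DiscreteMeasurableSpace V]
    (Γ : WeightedGraph V) (n : ℕ) (x y : V) : ℝ :=
  (Γ.walk x).real {ω | ω n = y} / Γ.mass y

/-- `p̃_n(x,y) = p_n(x,y) + p_{n+1}(x,y)`. -/
def heatTilde [Infinite V] [MeasurableSpace V] [DiscreteMeasurableSpace V]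
    (Γ : WeightedGraph V) (n : ℕ) (x y : V) : ℝ :=
  Γ.heat n x y + Γ.heat (n + 1) x y

/-- The open ball `B(x,R) = {y : d(x,y) < R}`. -/
def ball (Γ : WeightedGraph V) (x : V) (R : ℝ) : Set V := {y | (Γ.graph.dist x y : ℝ) < R}

/-- The volume `V(x,R) = μ(B(x,R))`. -/
def vol (Γ : WeightedGraph V) (x : V) (R : ℝ) : ℝ := ∑' y : Γ.ball x R, Γ.mass y

/-- The boundary `∂A`: the vertices outside `A` which have a neighbour in `A`. -/
def boundary (Γ : WeightedGraph V) (A : Set V) : Set V := {y | ∃ x ∈ A, Γ.graph.Adj x y} \ A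

/-- The exit time `T_A = inf {n ≥ 0 : X_n ∉ A}` (infinite if the path stays in `A`). -/
def exitTime (A : Set V) (ω : ℕ → V) : ℕ∞ := ⨅ (n : ℕ) (_ : ω n ∉ A), (n : ℕ∞)

/-- The hitting time `τ_A = T_{Aᶜ}`. -/
def hitTime (A : Set V) (ω : ℕ → V) : ℕ∞ := exitTime Aᶜ ω

/-- The mean exit time `E_y(A) = 𝔼(T_A | X_0 = y)`. -/
def meanExit [Infinite V] [MeasurableSpace V] [DiscreteMeasurableSpace V]
    (Γ : WeightedGraph V) (y : V) (A : Set V) : ℝ≥0∞ :=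
  ∫⁻ ω, (exitTime A ω : ℝ≥0∞) ∂(Γ.walk y)

/-- `E(x,R) = E_x(B(x,R))`. -/
def exitBall [Infinite V] [MeasurableSpace V] [DiscreteMeasurableSpace V]
    (Γ : WeightedGraph V) (x : V) (R : ℝ) : ℝ≥0∞ :=
  Γ.meanExit x (Γ.ball x R)

/-- The maximal mean exit time `max_{y ∈ B(x,R)} E_y(B(x,R))`. -/
def maxExitBall [Infinite V] [MeasurableSpace V] [DiscreteMeasurableSpace V]
    (Γ : WeightedGraph V) (x : V) (R : ℝ) : ℝ≥0∞ :=
  ⨆ y ∈ Γ.ball x R, Γ.meanExit y (Γ.ball x R)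

/-- `e(x,n)`: the least radius `r = 1, 2, …` with `E(x,r) ≥ n`. -/
def invExit [Infinite V] [MeasurableSpace V] [DiscreteMeasurableSpace V]
    (Γ : WeightedGraph V) (x : V) (n : ℕ) : ℕ :=
  sInf {r : ℕ | 1 ≤ r ∧ (n : ℝ≥0∞) ≤ Γ.exitBall x r}

/-- `π_{x,y}`: the union of the vertex sets of the shortest paths from `x` to `y`. -/
def geodesics (Γ : WeightedGraph V) (x y : V) : Set V :=
  {z | ∃ p : Γ.graph.Walk x y, p.length = Γ.graph.dist x y ∧ z ∈ p.support}

/-- The integers `l ≥ 1` with `t / l ≥ Q max_{z ∈ π_{x,y}} E(z, A R / l)`. -/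
def chainSet [Infinite V] [MeasurableSpace V] [DiscreteMeasurableSpace V]
    (Γ : WeightedGraph V) (Q A : ℝ) (x y : V) (t : ℝ) (R : ℕ) : Set ℕ :=
  {l : ℕ | 1 ≤ l ∧
    ENNReal.ofReal Q * (⨆ z ∈ Γ.geodesics x y, Γ.exitBall z (A * R / l)) ≤ ENNReal.ofReal (t / l)}

open Classical in
/-- `l_A(x,y,t,R)` with respect to the constant `Q`: the least element of `chainSet`, and `R` if
there is none. -/
def chainNumber [Infinite V] [MeasurableSpace V] [DiscreteMeasurableSpace V]
    (Γ : WeightedGraph V) (Q A : ℝ) (x y : V) (t : ℝ) (R : ℕ) : ℕ :=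
  if (Γ.chainSet Q A x y t R).Nonempty then sInf (Γ.chainSet Q A x y t R) else R

/-- Condition `(p₀)`: the transition probabilities along edges are bounded away from zero. -/
def UniformTrans (Γ : WeightedGraph V) : Prop :=
  ∃ p₀ : ℝ, 0 < p₀ ∧ ∀ x y, Γ.graph.Adj x y → p₀ ≤ Γ.trans x y

/-- Condition `(Ē)`: the maximal mean exit time of a ball is at most a constant times the mean exit
time from its centre. -/
def ExitCentered [Infinite V] [MeasurableSpace V] [DiscreteMeasurableSpace V]
    (Γ : WeightedGraph V) : Prop :=
  ∃ C : ℝ, 0 < C ∧ ∀ (x : V) (R : ℝ), 0 < R →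
    Γ.maxExitBall x R ≤ ENNReal.ofReal C * Γ.exitBall x R

/-- Very strong recurrence: from the boundary of `B(x,r)` the walk visits `x` before it leaves
`B(x,2r)` with probability at least a positive constant. -/
def VeryStronglyRecurrent [Infinite V] [MeasurableSpace V] [DiscreteMeasurableSpace V]
    (Γ : WeightedGraph V) : Prop :=
  ∃ c : ℝ, 0 < c ∧ ∀ (x : V) (r : ℕ), 1 ≤ r → ∀ w ∈ Γ.boundary (Γ.ball x r),
    c ≤ (Γ.walk w).real {ω | hitTime {x} ω < exitTime (Γ.ball x (2 * r)) ω}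

end WeightedGraph

end

noncomputable section

namespace WeightedGraph

variable {V : Type*}

/-! ### Finiteness of balls -/

/-! By reversibility the heat kernel may be read from `y` to `x`, and splitting at the first visit
to `x` bounds it below by the probability of hitting `x` from `y` by time `n`, times the least value
of `P_k(x,x) + P_{k+1}(x,x)` over `k ≤ n`, divided by `μ(x)` (`hitProb_mul_le_stepProb`).

On the diagonal (`exists_le_stepProb_diag`), `(Ē)` keeps the walk in `B(x, e(x,n))` up to a time
near `n/2` with probability bounded below. Cauchy-Schwarz turns this into a bound of order `1/V(x,
e(x,n))` at one even time of order `n`, and even-time return probabilities decrease.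

For the hitting probability (`pow_chainNumber_le_hitProb`), a geodesic is cut into `l` pieces of
length at most `d/l + 1`. Very strong recurrence makes the walk hit the next point before leaving a
ball of twice the distance, with probability at least `c`. By Markov's inequality and `(Ē)`, the
walk is still in that ball after time `n/l` with probability at most `c/2`, by the choice of `l`. So
each piece costs a factor `c/2`, and all pieces fit into time `n`. When `l ≥ d`, or no admissible
`l` exists, following a geodesic edge by edge already suffices. -/

theorem finite_neighbors [Infinite V] {Γ : WeightedGraph V} (hp : Γ.UniformTrans) (x : V) :
    {y | Γ.graph.Adj x y}.Finite := by
  obtain ⟨p, hp0, hp⟩ := hp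
  have hs : Summable (Γ.trans x) := (Γ.weight_summable x).div_const _
  -- The transition probabilities out of `x` are summable, so only finitely many reach `p`.
  have := hs.tendsto_cofinite_zero.eventually_lt_const hp0
  refine Set.Finite.subset this fun y hy => ?_
  simpa using hp x y hy

theorem finite_walk_length [Infinite V] {Γ : WeightedGraph V} (hp : Γ.UniformTrans) (n : ℕ)
    (x : V) : {y | ∃ p : Γ.graph.Walk x y, p.length = n}.Finite := by
  induction n generalizing x with
  | zero =>
    refine (Set.finite_singleton x).subset ?_
    rintro y ⟨p, hp⟩
    exact (SimpleGraph.Walk.eq_of_length_eq_zero hp).symm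
  | succ n ih =>
    refine ((finite_neighbors hp x).biUnion fun z _ => ih z).subset ?_
    rintro y ⟨p, hpl⟩
    cases p with
    | nil => simp at hpl
    | cons h q => exact Set.mem_biUnion h ⟨q, by simpa using hpl⟩

theorem finite_ball [Infinite V] {Γ : WeightedGraph V} (hp : Γ.UniformTrans) (x : V) (R : ℝ) :
    (Γ.ball x R).Finite := by
  obtain ⟨N, hN⟩ := exists_nat_ge R
  refine ((Set.finite_Iio N).biUnion fun n _ => finite_walk_length hp n x).subset fun y hy => ?_
  obtain ⟨p, hpl⟩ := (Γ.connected.preconnected x y).exists_walk_length_eq_dist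
  have : Γ.graph.dist x y < N := by exact_mod_cast (show (_ : ℝ) < R from hy).trans_le hN
  exact Set.mem_biUnion (show Γ.graph.dist x y ∈ Set.Iio N from this) ⟨p, hpl⟩

/-- Countability allows laws of finite histories to be compared on singletons. -/
theorem countable_vertices [Infinite V] {Γ : WeightedGraph V} (hp : Γ.UniformTrans) :
    Countable V := by
  have x : V := Classical.arbitrary V
  rw [← Set.countable_univ_iff]
  refine (Set.countable_iUnion fun n : ℕ => (finite_walk_length hp n x).countable).mono ?_
  intro y _
  obtain ⟨p⟩ := Γ.connected.preconnected x y
  exact Set.mem_iUnion.2 ⟨p.length, p, rfl⟩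

/-! ### The Markov property -/

theorem step_apply [Infinite V] (Γ : WeightedGraph V) (x y : V) :
    Γ.step x y = ENNReal.ofReal (Γ.trans x y) := rfl

theorem tsum_step [Infinite V] (Γ : WeightedGraph V) (x : V) : ∑' y, Γ.step x y = 1 :=
  (Γ.step x).tsum_coe

theorem step_eq_zero [Infinite V] (Γ : WeightedGraph V) {x y : V} (h : ¬ Γ.graph.Adj x y) :
    Γ.step x y = 0 := by
  rw [step_apply, trans, Γ.weight_zero x y h]; simp

/-- The trajectories which agree with `h` up to time `n`. -/
def pathCylinder (h : ℕ → V) (n : ℕ) : Set (ℕ → V) := {ω | ∀ i ≤ n, ω i = h i}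

theorem frestrictLe_preimage_singleton (h : ℕ → V) (n : ℕ) :
    (Preorder.frestrictLe (π := fun _ => V) n) ⁻¹' {Preorder.frestrictLe n h} =
      pathCylinder h n := by
  ext ω
  simp [pathCylinder, funext_iff]

/-- Prefix a trajectory by a vertex. -/
def pathCons (x : V) (ω : ℕ → V) : ℕ → V
  | 0 => x
  | n + 1 => ω n

@[simp] theorem pathCons_zero (x : V) (ω : ℕ → V) : pathCons x ω 0 = x := rfl

@[simp] theorem pathCons_succ (x : V) (ω : ℕ → V) (n : ℕ) : pathCons x ω (n + 1) = ω n := rfl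

variable [MeasurableSpace V]

theorem measurable_pathCons (x : V) : Measurable (pathCons x) := by
  refine measurable_pi_lambda _ fun n => ?_
  cases n with
  | zero => exact measurable_const
  | succ n => exact measurable_pi_apply n

theorem measurableSet_pathCylinder [DiscreteMeasurableSpace V] [Countable V] (h : ℕ → V) (n : ℕ) :
    MeasurableSet (pathCylinder h n) := by
  rw [← frestrictLe_preimage_singleton]
  exact Preorder.measurable_frestrictLe n (measurableSet_singleton _)

/-- Cylinders are the atoms of the countable space of histories up to time `n`, so they fix all
finite-dimensional laws, hence the measure by the π-system theorem. -/
theorem ext_of_pathCylinder [DiscreteMeasurableSpace V] [Countable V] {μ ν : Measure (ℕ → V)}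
    [IsFiniteMeasure μ] [IsFiniteMeasure ν]
    (h : ∀ f n, μ (pathCylinder f n) = ν (pathCylinder f n)) : μ = ν := by
  rcases isEmpty_or_nonempty V with hV | ⟨⟨v⟩⟩
  · exact Measure.ext fun s _ => by rw [Set.eq_empty_of_isEmpty s]; simp
  have key : ∀ n, μ.map (Preorder.frestrictLe n) = ν.map (Preorder.frestrictLe n) := by
    intro n
    refine Measure.ext_of_singleton fun a => ?_
    classical
    -- The value after time `n` is irrelevant; `v` is only padding.
    let f : ℕ → V := fun i => if hi : i ≤ n then a ⟨i, Finset.mem_Iic.2 hi⟩ else v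
    have hf : a = Preorder.frestrictLe (π := fun _ => V) n f := by
      ext ⟨i, hi⟩
      simp [f, Finset.mem_Iic.1 hi]
    rw [Measure.map_apply (by fun_prop) (measurableSet_singleton _),
      Measure.map_apply (by fun_prop) (measurableSet_singleton _), hf,
      frestrictLe_preimage_singleton, h]
  have gen : ∀ s ∈ measurableCylinders (fun _ : ℕ => V), μ s = ν s := by
    intro s hs
    obtain ⟨N, S, mS, rfl⟩ : ∃ N S, MeasurableSet S ∧ s = cylinder (Finset.Iic N) S := by
      simpa [measurableCylinders_nat] using hs
    have := congrArg (fun m => m S) (key N)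
    rwa [Measure.map_apply (by fun_prop) mS, Measure.map_apply (by fun_prop) mS] at this
  refine ext_of_generate_finite _ generateFrom_measurableCylinders.symm
    isPiSystem_measurableCylinders gen (gen _ (univ_mem_measurableCylinders _))

variable [Infinite V] [DiscreteMeasurableSpace V]

instance (Γ : WeightedGraph V) (x : V) : IsProbabilityMeasure (Γ.walk x) := by
  unfold walk; infer_instance

theorem walk_pathCylinder_zero [Countable V] (Γ : WeightedGraph V) (x : V) (h : ℕ → V) :
    Γ.walk x (pathCylinder h 0) = ({h 0} : Set V).indicator 1 x := by
  rw [← frestrictLe_preimage_singleton, ← Measure.map_apply (by fun_prop)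
    (measurableSet_singleton _), walk, Kernel.traj_map_frestrictLe_apply, Kernel.partialTraj_self,
    Kernel.id_apply, Measure.dirac_apply]
  by_cases hx : x = h 0
  · subst hx
    rw [Set.indicator_of_mem, Set.indicator_of_mem] <;> simp
    ext i; have := Finset.mem_Iic.1 i.2
    simp at this
    simp [this]
  · rw [Set.indicator_of_notMem, Set.indicator_of_notMem] <;> simp [hx]
    intro h'
    exact hx (congrFun h' ⟨0, by simp⟩)

theorem walk_pathCylinder_succ [Countable V] (Γ : WeightedGraph V) (x : V) (h : ℕ → V) (n : ℕ) :
    Γ.walk x (pathCylinder h (n + 1)) =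
      Γ.walk x (pathCylinder h n) * Γ.step (h n) (h (n + 1)) := by
  have key := Kernel.partialTraj_compProd_eq_map_traj (X := fun _ => V) (κ := Γ.stepKernel)
    (zero_le (a := n)) (x₀ := fun _ => x)
  have := congrArg (fun m => m ({Preorder.frestrictLe n h} ×ˢ {h (n + 1)})) key
  rw [Measure.compProd_apply_prod (measurableSet_singleton _) (measurableSet_singleton _),
    Measure.map_apply (by fun_prop) ((measurableSet_singleton _).prod (measurableSet_singleton _)),
    Measure.restrict_singleton, lintegral_smul_measure, lintegral_dirac,
    ← Kernel.traj_map_frestrictLe_apply, Measure.map_apply (by fun_prop)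
    (measurableSet_singleton _), frestrictLe_preimage_singleton] at this
  rw [walk]
  convert this.symm using 2
  · ext ω
    simp only [pathCylinder, Set.mem_ofPred_eq, Set.mem_preimage, Set.mem_prod,
      Set.mem_singleton_iff, funext_iff, Preorder.frestrictLe_apply, Subtype.forall,
      Finset.mem_Iic]
    constructor
    · exact fun H => ⟨fun i hi => H i (by omega), H _ le_rfl⟩
    · rintro ⟨H1, H2⟩ i hi
      rcases Nat.le_succ_iff.1 hi with hi | rfl
      exacts [H1 i hi, H2]
  · rw [smul_eq_mul]
    exact congrArg _ ((Γ.step (h n)).toMeasure_apply_singleton (h (n + 1))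
      (measurableSet_singleton _)).symm

/-- Both sides agree on cylinders, since lengthening a cylinder by one step multiplies either mass
by the same transition probability. The first-step recursions derived from this stand in for the
strong Markov property. -/
theorem walk_eq_sum [Countable V] (Γ : WeightedGraph V) (x : V) :
    Γ.walk x = Measure.sum fun y => Γ.step x y • (Γ.walk y).map (pathCons x) := by
  have mC := measurable_pathCons x
  have hfin : IsFiniteMeasure
      (Measure.sum fun y => Γ.step x y • (Γ.walk y).map (pathCons x)) := by
    refine ⟨?_⟩
    rw [Measure.sum_apply _ .univ]
    simp [Measure.map_apply mC .univ]
  refine ext_of_pathCylinder fun h n => ?_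
  rw [Measure.sum_apply _ (measurableSet_pathCylinder _ _)]
  simp only [Measure.smul_apply, smul_eq_mul,
    Measure.map_apply mC (measurableSet_pathCylinder _ _)]
  induction n with
  | zero =>
    rw [walk_pathCylinder_zero]
    by_cases hx : x = h 0
    · have : pathCons x ⁻¹' pathCylinder h 0 = Set.univ := by
        ext ω; simp [pathCylinder, hx]
      simp only [this, measure_univ, mul_one, tsum_step]
      simp [hx]
    · have : pathCons x ⁻¹' pathCylinder h 0 = ∅ := by
        ext ω; simp [pathCylinder, hx]
      simp [this, hx]
  | succ n ih =>
    rw [walk_pathCylinder_succ, ih, ← ENNReal.tsum_mul_right]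
    by_cases hx : x = h 0
    · have hpre : ∀ n, pathCons x ⁻¹' pathCylinder h (n + 1) =
          pathCylinder (fun i => h (i + 1)) n := by
        intro n; ext ω
        simp only [pathCylinder, Set.mem_ofPred_eq, Set.mem_preimage]
        constructor
        · exact fun H i hi => by simpa using H (i + 1) (by omega)
        · intro H i hi
          cases i with
          | zero => exact hx
          | succ i => exact H i (by omega)
      -- For `n = 0` the shorter cylinder imposes no condition after the first step, so the first
      -- step itself supplies the new factor.
      cases n with
      | zero =>
        have : pathCons x ⁻¹' pathCylinder h 0 = Set.univ := by
          ext ω; simp [pathCylinder, hx]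
        simp only [this, hpre, walk_pathCylinder_zero, measure_univ, mul_one]
        rw [ENNReal.tsum_mul_right, tsum_step, one_mul, tsum_eq_single (h 1)]
        · simp [hx]
        · intro y hy; simp [hy]
      | succ n =>
        simp only [hpre, walk_pathCylinder_succ, mul_assoc]
    · have : ∀ n, pathCons x ⁻¹' pathCylinder h n = ∅ := by
        intro n; ext ω
        simp only [pathCylinder, Set.mem_preimage, Set.mem_ofPred_eq, Set.mem_empty_iff_false,
          iff_false]
        exact fun H => hx (H 0 (Nat.zero_le _))
      simp [this]

/-- The Markov property at time one. -/
theorem walk_apply [Countable V] (Γ : WeightedGraph V) (x : V) {A : Set (ℕ → V)}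
    (hA : MeasurableSet A) :
    Γ.walk x A = ∑' y, Γ.step x y * Γ.walk y (pathCons x ⁻¹' A) := by
  conv_lhs => rw [walk_eq_sum]
  rw [Measure.sum_apply _ hA]
  simp [Measure.map_apply (measurable_pathCons x) hA]

end WeightedGraph

end

/-! ### Staying, exit and hitting times -/

noncomputable section

namespace WeightedGraph

variable {V : Type*}

theorem coe_lt_exitTime_iff (A : Set V) (ω : ℕ → V) (k : ℕ) :
    (k : ℕ∞) < exitTime A ω ↔ ∀ i ≤ k, ω i ∈ A := by
  constructor
  · intro h i hi
    by_contra hA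
    exact absurd h (not_lt.2 ((iInf₂_le i hA).trans (by exact_mod_cast hi)))
  · intro h
    refine (show (k : ℕ∞) < ((k + 1 : ℕ) : ℕ∞) by exact_mod_cast k.lt_succ_self).trans_le
      (le_iInf₂ fun n hn => ?_)
    by_contra hlt
    have : n < k + 1 := by exact_mod_cast not_le.1 hlt
    exact hn (h n (by omega))

theorem tsum_indicator_lt_enat (T : ℕ∞) :
    (T : ℝ≥0∞) = ∑' k : ℕ, {k : ℕ | (k : ℕ∞) < T}.indicator (fun _ => (1 : ℝ≥0∞)) k := by
  induction T using ENat.recTopCoe with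
  | top => simp
  | coe n =>
    rw [tsum_eq_sum (s := Finset.range n)]
    · rw [Finset.sum_congr rfl (g := fun _ => (1 : ℝ≥0∞))]
      · simp
      · intro k hk
        simpa using hk
    · intro k hk
      simpa using hk

variable [MeasurableSpace V] [DiscreteMeasurableSpace V]

theorem measurableSet_eq (n : ℕ) (x : V) : MeasurableSet {ω : ℕ → V | ω n = x} :=
  (measurable_pi_apply n : Measurable fun ω : ℕ → V => ω n) (measurableSet_singleton x)

theorem measurableSet_hit (n : ℕ) (x : V) : MeasurableSet {ω : ℕ → V | ∃ i ≤ n, ω i = x} := by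
  have : {ω : ℕ → V | ∃ i ≤ n, ω i = x} = ⋃ i ∈ Set.Iic n, {ω | ω i = x} := by ext; simp
  rw [this]
  exact .biUnion (Set.to_countable _) fun i _ => measurableSet_eq i x

theorem measurableSet_stay (n : ℕ) (A : Set V) :
    MeasurableSet {ω : ℕ → V | ∀ i ≤ n, ω i ∈ A} := by
  have : {ω : ℕ → V | ∀ i ≤ n, ω i ∈ A} = ⋂ i ∈ Set.Iic n, {ω | ω i ∈ A} := by ext; simp
  rw [this]
  exact .biInter (Set.to_countable _) fun i _ => measurable_pi_apply i (MeasurableSet.of_discrete)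

variable [Infinite V]

/-- The probability that the walk from `x` is at `y` at time `n`. -/
def stepProb (Γ : WeightedGraph V) (n : ℕ) (x y : V) : ℝ≥0∞ := Γ.walk x {ω | ω n = y}

/-- The probability that the walk from `y` visits `x` up to time `n`. -/
def hitProb (Γ : WeightedGraph V) (n : ℕ) (y x : V) : ℝ≥0∞ := Γ.walk y {ω | ∃ i ≤ n, ω i = x}

/-- The probability that the walk from `y` stays in `A` up to time `n`. -/
def stayProb (Γ : WeightedGraph V) (n : ℕ) (y : V) (A : Set V) : ℝ≥0∞ :=
  Γ.walk y {ω | ∀ i ≤ n, ω i ∈ A}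

theorem stepProb_le_one (Γ : WeightedGraph V) (n : ℕ) (x y : V) : Γ.stepProb n x y ≤ 1 :=
  prob_le_one

theorem hitProb_le_one (Γ : WeightedGraph V) (n : ℕ) (x y : V) : Γ.hitProb n x y ≤ 1 :=
  prob_le_one

theorem stayProb_le_one (Γ : WeightedGraph V) (n : ℕ) (y : V) (A : Set V) :
    Γ.stayProb n y A ≤ 1 :=
  prob_le_one

theorem hitProb_mono (Γ : WeightedGraph V) {m n : ℕ} (h : m ≤ n) (y x : V) :
    Γ.hitProb m y x ≤ Γ.hitProb n y x :=
  measure_mono fun _ ⟨i, hi, hx⟩ => ⟨i, hi.trans h, hx⟩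

theorem stayProb_anti (Γ : WeightedGraph V) {m n : ℕ} (h : m ≤ n) (y : V) (A : Set V) :
    Γ.stayProb n y A ≤ Γ.stayProb m y A :=
  measure_mono fun _ H i hi => H i (hi.trans h)

section Recursion

variable [Countable V]

theorem walk_apply_of_preimage_eq (Γ : WeightedGraph V) (x : V) {A B : Set (ℕ → V)}
    (hA : MeasurableSet A) (h : pathCons x ⁻¹' A = B) :
    Γ.walk x A = ∑' y, Γ.step x y * Γ.walk y B := by
  rw [walk_apply Γ x hA, h]

theorem walk_eq_one (Γ : WeightedGraph V) (x : V) {A : Set (ℕ → V)}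
    (hA : MeasurableSet A) (h : pathCons x ⁻¹' A = Set.univ) : Γ.walk x A = 1 := by
  simp only [walk_apply_of_preimage_eq Γ x hA h, measure_univ, mul_one, tsum_step]

theorem walk_eq_zero (Γ : WeightedGraph V) (x : V) {A : Set (ℕ → V)}
    (hA : MeasurableSet A) (h : pathCons x ⁻¹' A = ∅) : Γ.walk x A = 0 := by
  simp [walk_apply_of_preimage_eq Γ x hA h]

theorem stepProb_zero_self (Γ : WeightedGraph V) (x : V) : Γ.stepProb 0 x x = 1 :=
  walk_eq_one Γ x (measurableSet_eq _ _) (by ext; simp)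

theorem stepProb_zero_of_ne (Γ : WeightedGraph V) {x y : V} (h : x ≠ y) :
    Γ.stepProb 0 x y = 0 :=
  walk_eq_zero Γ x (measurableSet_eq _ _) (by ext; simp [h])

theorem stepProb_succ (Γ : WeightedGraph V) (n : ℕ) (x y : V) :
    Γ.stepProb (n + 1) x y = ∑' z, Γ.step x z * Γ.stepProb n z y :=
  walk_apply_of_preimage_eq Γ x (measurableSet_eq _ _) (by ext; simp)

theorem hitProb_self (Γ : WeightedGraph V) (n : ℕ) (x : V) : Γ.hitProb n x x = 1 := by
  refine walk_eq_one Γ x (measurableSet_hit _ _) ?_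
  ext ω
  simp only [Set.mem_preimage, Set.mem_ofPred_eq, Set.mem_univ, iff_true]
  exact ⟨0, Nat.zero_le _, rfl⟩

theorem hitProb_zero_of_ne (Γ : WeightedGraph V) {x y : V} (h : y ≠ x) :
    Γ.hitProb 0 y x = 0 :=
  walk_eq_zero Γ y (measurableSet_hit _ _) (by ext; simp [h])

theorem hitProb_succ_of_ne (Γ : WeightedGraph V) (n : ℕ) {x y : V} (h : y ≠ x) :
    Γ.hitProb (n + 1) y x = ∑' z, Γ.step y z * Γ.hitProb n z x := by
  refine walk_apply_of_preimage_eq Γ y (measurableSet_hit _ _) ?_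
  ext ω
  simp only [Set.mem_preimage, Set.mem_ofPred_eq]
  constructor
  · rintro ⟨i, hi, hx⟩
    cases i with
    | zero => exact absurd hx h
    | succ i => exact ⟨i, by omega, hx⟩
  · rintro ⟨i, hi, hx⟩
    exact ⟨i + 1, by omega, hx⟩

theorem stayProb_of_notMem (Γ : WeightedGraph V) (n : ℕ) {y : V} {A : Set V} (h : y ∉ A) :
    Γ.stayProb n y A = 0 := by
  refine walk_eq_zero Γ y (measurableSet_stay _ _) ?_
  ext ω
  simp only [Set.mem_preimage, Set.mem_ofPred_eq, Set.mem_empty_iff_false, iff_false]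
  exact fun H => h (H 0 (Nat.zero_le _))

theorem stayProb_zero (Γ : WeightedGraph V) {y : V} {A : Set V} (h : y ∈ A) :
    Γ.stayProb 0 y A = 1 :=
  walk_eq_one Γ y (measurableSet_stay _ _) (by ext; simp [h])

theorem stayProb_succ (Γ : WeightedGraph V) (n : ℕ) {y : V} {A : Set V} (h : y ∈ A) :
    Γ.stayProb (n + 1) y A = ∑' z, Γ.step y z * Γ.stayProb n z A := by
  refine walk_apply_of_preimage_eq Γ y (measurableSet_stay _ _) ?_
  ext ω
  simp only [Set.mem_preimage, Set.mem_ofPred_eq]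
  constructor
  · exact fun H i hi => H (i + 1) (by omega)
  · intro H i hi
    cases i with
    | zero => exact h
    | succ i => exact H i (by omega)

/-! ### Mean exit times -/

omit [Countable V] in
-- The tail-sum formula, since staying in `A` up to time `k` means `T_A > k`.
theorem meanExit_eq_tsum (Γ : WeightedGraph V) (y : V) (A : Set V) :
    Γ.meanExit y A = ∑' k, Γ.stayProb k y A := by
  have h : ∀ ω : ℕ → V, (exitTime A ω : ℝ≥0∞) =
      ∑' k : ℕ, {ω : ℕ → V | ∀ i ≤ k, ω i ∈ A}.indicator (fun _ => (1 : ℝ≥0∞)) ω := by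
    intro ω
    rw [tsum_indicator_lt_enat]
    refine tsum_congr fun k => ?_
    by_cases hk : ∀ i ≤ k, ω i ∈ A
    · rw [Set.indicator_of_mem (by simpa [coe_lt_exitTime_iff] using hk),
        Set.indicator_of_mem (by simpa using hk)]
    · rw [Set.indicator_of_notMem (by simpa [coe_lt_exitTime_iff] using hk),
        Set.indicator_of_notMem (by simpa using hk)]
  simp only [meanExit, h]
  rw [lintegral_tsum fun k =>
    (measurable_const.indicator (measurableSet_stay k A)).aemeasurable]
  refine tsum_congr fun k => ?_
  rw [lintegral_indicator_const (measurableSet_stay k A), one_mul, stayProb]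

theorem meanExit_of_notMem (Γ : WeightedGraph V) {y : V} {A : Set V} (h : y ∉ A) :
    Γ.meanExit y A = 0 := by
  simp [meanExit_eq_tsum, stayProb_of_notMem Γ _ h]

theorem meanExit_of_mem (Γ : WeightedGraph V) {y : V} {A : Set V} (h : y ∈ A) :
    Γ.meanExit y A = 1 + ∑' z, Γ.step y z * Γ.meanExit z A := by
  rw [meanExit_eq_tsum, tsum_eq_zero_add' ENNReal.summable, stayProb_zero Γ h]
  simp only [stayProb_succ Γ _ h, meanExit_eq_tsum, ← ENNReal.tsum_mul_left]
  rw [ENNReal.tsum_comm]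

/-- Time up to `n` contributes at most `n`; if the walk is still in `A`, the remaining mean time is
at most `M`. With `(Ē)` this bounds the staying probability from below. -/
theorem meanExit_le_add_stayProb_mul (Γ : WeightedGraph V) {A : Set V} {M : ℝ≥0∞}
    (hM : ∀ z ∈ A, Γ.meanExit z A ≤ M) (n : ℕ) (y : V) :
    Γ.meanExit y A ≤ n + Γ.stayProb n y A * M := by
  by_cases hy : y ∈ A
  swap
  · simp [meanExit_of_notMem Γ hy]
  induction n generalizing y with
  | zero => simpa [stayProb_zero Γ hy] using hM y hy
  | succ n ih =>
    have ih' : ∀ z, Γ.meanExit z A ≤ n + Γ.stayProb n z A * M := by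
      intro z
      by_cases hz : z ∈ A
      · exact ih z hz
      · simp [meanExit_of_notMem Γ hz]
    rw [meanExit_of_mem Γ hy, stayProb_succ Γ _ hy, ← ENNReal.tsum_mul_right]
    calc 1 + ∑' z, Γ.step y z * Γ.meanExit z A
        ≤ 1 + ∑' z, Γ.step y z * (n + Γ.stayProb n z A * M) := by gcongr; exact ih' _
      _ = _ := by
        simp only [mul_add, ENNReal.tsum_add, ENNReal.tsum_mul_right, tsum_step, one_mul,
          ← mul_assoc]
        push_cast
        ring

omit [Countable V] in
-- Markov's inequality for `T_A ≥ n + 1`.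
theorem succ_mul_stayProb_le (Γ : WeightedGraph V) (n : ℕ) (y : V) (A : Set V) :
    (n + 1) * Γ.stayProb n y A ≤ Γ.meanExit y A := by
  rw [meanExit_eq_tsum]
  calc (n + 1) * Γ.stayProb n y A = ∑ k ∈ Finset.range (n + 1), Γ.stayProb n y A := by simp
    _ ≤ ∑ k ∈ Finset.range (n + 1), Γ.stayProb k y A :=
      Finset.sum_le_sum fun k hk => Γ.stayProb_anti (by simpa [Nat.lt_succ_iff] using hk) _ _
    _ ≤ _ := ENNReal.sum_le_tsum _

omit [Countable V] in
theorem meanExit_mono (Γ : WeightedGraph V) (y : V) {A B : Set V} (h : A ⊆ B) :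
    Γ.meanExit y A ≤ Γ.meanExit y B := by
  simp only [meanExit_eq_tsum]
  exact ENNReal.tsum_le_tsum fun k => measure_mono fun ω H i hi => h (H i hi)

omit [Countable V] in
theorem exitBall_mono (Γ : WeightedGraph V) (x : V) {R S : ℝ} (h : R ≤ S) :
    Γ.exitBall x R ≤ Γ.exitBall x S :=
  Γ.meanExit_mono x fun _ hy => lt_of_lt_of_le hy h

/-- The exit time of a ball is at least the distance to its complement. -/
theorem le_meanExit_ball (Γ : WeightedGraph V) (x : V) (r m : ℕ) (y : V)
    (h : Γ.graph.dist x y + m ≤ r) : (m : ℝ≥0∞) ≤ Γ.meanExit y (Γ.ball x r) := by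
  induction m generalizing y with
  | zero => simp
  | succ m ih =>
    have hy : y ∈ Γ.ball x r := by
      change (Γ.graph.dist x y : ℝ) < r
      exact_mod_cast (by omega : Γ.graph.dist x y < r)
    rw [meanExit_of_mem Γ hy, Nat.cast_succ, add_comm]
    gcongr
    calc (m : ℝ≥0∞) = ∑' z, Γ.step y z * m := by
          rw [ENNReal.tsum_mul_right, tsum_step, one_mul]
      _ ≤ _ := by
          refine ENNReal.tsum_le_tsum fun z => ?_
          by_cases hz : Γ.graph.Adj y z
          · have h1 := Γ.connected.dist_triangle (u := x) (v := y) (w := z)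
            rw [SimpleGraph.dist_eq_one_iff_adj.2 hz] at h1
            gcongr
            exact ih z (by omega)
          · simp [step_eq_zero Γ hz]

theorem le_exitBall (Γ : WeightedGraph V) (x : V) (r : ℕ) : (r : ℝ≥0∞) ≤ Γ.exitBall x r :=
  Γ.le_meanExit_ball x r r x (by simp)

/-- The infimum is attained because leaving `B(x,r)` takes at least `r` steps, so `r = n + 1`
qualifies. -/
theorem invExit_mem (Γ : WeightedGraph V) (x : V) (n : ℕ) :
    1 ≤ Γ.invExit x n ∧ (n : ℝ≥0∞) ≤ Γ.exitBall x (Γ.invExit x n) := by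
  refine Nat.sInf_mem (s := {r : ℕ | 1 ≤ r ∧ (n : ℝ≥0∞) ≤ Γ.exitBall x r}) ⟨n + 1, by omega, ?_⟩
  exact le_trans (by simp) (Γ.le_exitBall x (n + 1))

/-! ### Hitting probabilities -/

/-- Decomposition at the first visit to `x`: the time `k` left after it can be anything up to `n`,
so `a` must be a uniform bound. -/
theorem hitProb_mul_le_stepProb (Γ : WeightedGraph V) (x : V) {a : ℝ≥0∞} (n : ℕ)
    (ha : ∀ k ≤ n, a ≤ Γ.stepProb k x x + Γ.stepProb (k + 1) x x) (y : V) :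
    Γ.hitProb n y x * a ≤ Γ.stepProb n y x + Γ.stepProb (n + 1) y x := by
  induction n generalizing y with
  | zero =>
    by_cases hy : y = x
    · subst hy
      simpa [hitProb_self] using ha 0 le_rfl
    · simp [hitProb_zero_of_ne Γ hy]
  | succ n ih =>
    by_cases hy : y = x
    · subst hy
      simpa [hitProb_self] using ha (n + 1) le_rfl
    · rw [hitProb_succ_of_ne Γ n hy, stepProb_succ, stepProb_succ Γ (n + 1), ← ENNReal.tsum_add,
        ← ENNReal.tsum_mul_right]
      refine ENNReal.tsum_le_tsum fun z => ?_
      rw [mul_assoc, ← mul_add]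
      gcongr
      exact ih (fun k hk => ha k (by omega)) z

/-- Restarting at the first visit to `w`; this is what makes chaining possible. -/
theorem hitProb_mul_hitProb_le (Γ : WeightedGraph V) (s t : ℕ) (y w x : V) :
    Γ.hitProb s y w * Γ.hitProb t w x ≤ Γ.hitProb (s + t) y x := by
  induction s generalizing y with
  | zero =>
    by_cases hy : y = w
    · subst hy; simp [hitProb_self]
    · simp [hitProb_zero_of_ne Γ hy]
  | succ s ih =>
    by_cases hy : y = w
    · subst hy
      rw [hitProb_self, one_mul]
      exact Γ.hitProb_mono (by omega) _ _
    · by_cases hx : y = x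
      · subst hx
        rw [hitProb_self]
        exact mul_le_one' (Γ.hitProb_le_one _ _ _) (Γ.hitProb_le_one _ _ _)
      · rw [hitProb_succ_of_ne Γ s hy, add_right_comm, hitProb_succ_of_ne Γ _ hx,
          ← ENNReal.tsum_mul_right]
        refine ENNReal.tsum_le_tsum fun z => ?_
        rw [mul_assoc]
        gcongr
        exact ih z

omit [MeasurableSpace V] [DiscreteMeasurableSpace V] [Countable V] in
theorem le_step (Γ : WeightedGraph V) {p : ℝ} (hp : ∀ x y, Γ.graph.Adj x y → p ≤ Γ.trans x y)
    {x y : V} (h : Γ.graph.Adj x y) : ENNReal.ofReal p ≤ Γ.step x y :=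
  ENNReal.ofReal_le_ofReal (hp x y h)

theorem pow_length_le_hitProb (Γ : WeightedGraph V) {p : ℝ}
    (hp : ∀ x y, Γ.graph.Adj x y → p ≤ Γ.trans x y) {y x : V} (q : Γ.graph.Walk y x) :
    ENNReal.ofReal p ^ q.length ≤ Γ.hitProb q.length y x := by
  induction q with
  | nil => simp [hitProb_self]
  | @cons u v w h q ih =>
    have h1 : ENNReal.ofReal p ≤ Γ.hitProb 1 u v := by
      rw [hitProb_succ_of_ne Γ 0 h.ne]
      refine le_trans ?_ (ENNReal.le_tsum v)
      rw [hitProb_self, mul_one]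
      exact Γ.le_step hp h
    rw [SimpleGraph.Walk.length_cons, add_comm, pow_add, pow_one]
    exact (mul_le_mul' h1 ih).trans (Γ.hitProb_mul_hitProb_le _ _ _ _ _)

theorem pow_dist_le_hitProb (Γ : WeightedGraph V) {p : ℝ}
    (hp : ∀ x y, Γ.graph.Adj x y → p ≤ Γ.trans x y) (y x : V) {n : ℕ}
    (hn : Γ.graph.dist y x ≤ n) :
    ENNReal.ofReal p ^ Γ.graph.dist y x ≤ Γ.hitProb n y x := by
  obtain ⟨q, hq⟩ := (Γ.connected.preconnected y x).exists_walk_length_eq_dist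
  have := Γ.pow_length_le_hitProb hp q
  rw [hq] at this
  exact this.trans (Γ.hitProb_mono hn _ _)

end Recursion

end WeightedGraph

end

/-! ### Reversibility and return probabilities -/

noncomputable section

theorem ENNReal.two_mul_mul_le_sq_add_sq (a b : ℝ≥0∞) : 2 * (a * b) ≤ a ^ 2 + b ^ 2 := by
  wlog h : a ≤ b generalizing a b
  · rw [mul_comm a b, add_comm]
    exact this b a (le_of_not_ge h)
  obtain ⟨c, rfl⟩ := exists_add_of_le h
  calc 2 * (a * (a + c)) ≤ 2 * (a * (a + c)) + c ^ 2 := le_self_add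
    _ = _ := by ring

/-- Jensen's inequality for the square and a discrete probability distribution. -/
theorem ENNReal.sq_tsum_mul_le {ι : Type*} {p g : ι → ℝ≥0∞} (hp : ∑' i, p i = 1) :
    (∑' i, p i * g i) ^ 2 ≤ ∑' i, p i * g i ^ 2 := by
  have h : 2 * (∑' i, p i * g i) ^ 2 ≤ 2 * ∑' i, p i * g i ^ 2 := by
    calc 2 * (∑' i, p i * g i) ^ 2
        = ∑' i, ∑' j, p i * (p j * (2 * (g i * g j))) := by
          rw [sq, ← ENNReal.tsum_mul_right, ← ENNReal.tsum_mul_left]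
          refine tsum_congr fun i => ?_
          rw [← ENNReal.tsum_mul_left, ← ENNReal.tsum_mul_left]
          refine tsum_congr fun j => ?_
          ring
      _ ≤ ∑' i, ∑' j, p i * (p j * (g i ^ 2 + g j ^ 2)) := by
          gcongr
          exact ENNReal.two_mul_mul_le_sq_add_sq _ _
      _ = _ := by
          simp only [ENNReal.tsum_mul_left, mul_add, ENNReal.tsum_add, ENNReal.tsum_mul_right, hp,
            one_mul]
          ring
  exact (ENNReal.mul_le_mul_iff_right (by simp) (by simp)).1 h

namespace WeightedGraph

variable {V : Type*} [Infinite V]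

theorem ofReal_mass_mul_step (Γ : WeightedGraph V) (x y : V) :
    ENNReal.ofReal (Γ.mass x) * Γ.step x y = ENNReal.ofReal (Γ.weight x y) := by
  rw [step_apply, ← ENNReal.ofReal_mul (Γ.mass_pos x).le, trans,
    mul_div_cancel₀ _ (Γ.mass_pos x).ne']

theorem vol_eq_sum {Γ : WeightedGraph V} (hp : Γ.UniformTrans) (x : V) (R : ℝ) :
    Γ.vol x R = ∑ y ∈ (finite_ball hp x R).toFinset, Γ.mass y := by
  rw [vol, tsum_subtype, tsum_eq_sum (s := (finite_ball hp x R).toFinset)]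
  · exact Finset.sum_congr rfl fun y hy => Set.indicator_of_mem (by simpa using hy) _
  · exact fun y hy => Set.indicator_of_notMem (by simpa using hy) _

theorem mass_le_vol {Γ : WeightedGraph V} (hp : Γ.UniformTrans) (x : V) {R : ℝ} (hR : 0 < R) :
    Γ.mass x ≤ Γ.vol x R := by
  rw [vol_eq_sum hp]
  refine Finset.single_le_sum (f := Γ.mass) (fun y _ => (Γ.mass_pos y).le) ?_
  simpa [ball] using hR

variable [MeasurableSpace V] [DiscreteMeasurableSpace V]

section Recursion

variable [Countable V]

theorem stepProb_one (Γ : WeightedGraph V) (x y : V) : Γ.stepProb 1 x y = Γ.step x y := by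
  rw [stepProb_succ, tsum_eq_single y]
  · rw [stepProb_zero_self, mul_one]
  · intro z hz
    rw [stepProb_zero_of_ne Γ hz, mul_zero]

/-- The Chapman-Kolmogorov equation. -/
theorem stepProb_add (Γ : WeightedGraph V) (m n : ℕ) (x y : V) :
    Γ.stepProb (m + n) x y = ∑' z, Γ.stepProb m x z * Γ.stepProb n z y := by
  induction m generalizing x with
  | zero =>
    rw [zero_add, tsum_eq_single x]
    · rw [stepProb_zero_self, one_mul]
    · intro z hz
      rw [stepProb_zero_of_ne Γ hz.symm, zero_mul]
  | succ m ih =>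
    rw [add_right_comm, stepProb_succ]
    simp only [ih, stepProb_succ Γ m, ← ENNReal.tsum_mul_left, ← ENNReal.tsum_mul_right]
    rw [ENNReal.tsum_comm]
    simp only [mul_assoc]

/-- The random walk is reversible with respect to the measure `μ`. -/
theorem ofReal_mass_mul_stepProb (Γ : WeightedGraph V) (n : ℕ) (x y : V) :
    ENNReal.ofReal (Γ.mass x) * Γ.stepProb n x y =
      ENNReal.ofReal (Γ.mass y) * Γ.stepProb n y x := by
  induction n generalizing x with
  | zero =>
    rcases eq_or_ne x y with rfl | h
    · rfl
    · rw [stepProb_zero_of_ne Γ h, stepProb_zero_of_ne Γ h.symm, mul_zero, mul_zero]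
  | succ n ih =>
    rw [stepProb_succ, stepProb_add, ← ENNReal.tsum_mul_left, ← ENNReal.tsum_mul_left]
    refine tsum_congr fun z => ?_
    rw [← mul_assoc, ofReal_mass_mul_step, weight_symm, ← ofReal_mass_mul_step, stepProb_one,
      ← mul_assoc, ← ih]
    ring

theorem ofReal_mass_mul_stepProb_two_mul (Γ : WeightedGraph V) (k : ℕ) (x : V) :
    ENNReal.ofReal (Γ.mass x) * Γ.stepProb (2 * k) x x =
      ∑' z, ENNReal.ofReal (Γ.mass z) * Γ.stepProb k z x ^ 2 := by
  rw [two_mul, stepProb_add, ← ENNReal.tsum_mul_left]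
  refine tsum_congr fun z => ?_
  rw [← mul_assoc, ofReal_mass_mul_stepProb]
  ring

/-- The return probability at time `2k` is, up to `μ(x)`, the squared `ℓ²(μ)` norm of `P_k(·,x)`.
The transition operator contracts this norm, by Jensen and invariance of `μ`. -/
theorem stepProb_two_mul_succ_le (Γ : WeightedGraph V) (k : ℕ) (x : V) :
    Γ.stepProb (2 * (k + 1)) x x ≤ Γ.stepProb (2 * k) x x := by
  have h : ENNReal.ofReal (Γ.mass x) * Γ.stepProb (2 * (k + 1)) x x ≤
      ENNReal.ofReal (Γ.mass x) * Γ.stepProb (2 * k) x x := by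
    rw [ofReal_mass_mul_stepProb_two_mul, ofReal_mass_mul_stepProb_two_mul]
    calc ∑' z, ENNReal.ofReal (Γ.mass z) * Γ.stepProb (k + 1) z x ^ 2
        ≤ ∑' z, ENNReal.ofReal (Γ.mass z) * ∑' w, Γ.step z w * Γ.stepProb k w x ^ 2 := by
          gcongr with z
          rw [stepProb_succ]
          exact ENNReal.sq_tsum_mul_le (tsum_step Γ z)
      _ = ∑' w, ∑' z, ENNReal.ofReal (Γ.mass w) * Γ.step w z * Γ.stepProb k w x ^ 2 := by
          simp only [← ENNReal.tsum_mul_left, ← mul_assoc]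
          rw [ENNReal.tsum_comm]
          simp only [ofReal_mass_mul_step]
          refine tsum_congr fun w => tsum_congr fun z => ?_
          rw [weight_symm]
      _ = _ := by
          simp only [ENNReal.tsum_mul_right, ENNReal.tsum_mul_left, tsum_step, mul_one]
  exact (ENNReal.mul_le_mul_iff_right (by simpa using Γ.mass_pos x) (by simp)).1 h

theorem antitone_stepProb_two_mul (Γ : WeightedGraph V) (x : V) :
    Antitone fun k => Γ.stepProb (2 * k) x x :=
  antitone_nat_of_succ_le fun k => Γ.stepProb_two_mul_succ_le k x

/-- Whatever the first step, the same edge can be crossed back. -/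
theorem le_stepProb_two (Γ : WeightedGraph V) {p : ℝ}
    (hp : ∀ x y, Γ.graph.Adj x y → p ≤ Γ.trans x y) (x : V) :
    ENNReal.ofReal p ≤ Γ.stepProb 2 x x := by
  rw [stepProb_succ]
  calc ENNReal.ofReal p = ∑' z, Γ.step x z * ENNReal.ofReal p := by
        rw [ENNReal.tsum_mul_right, tsum_step, one_mul]
    _ ≤ _ := by
        refine ENNReal.tsum_le_tsum fun z => ?_
        by_cases hz : Γ.graph.Adj x z
        · gcongr
          rw [stepProb_one]
          exact Γ.le_step hp hz.symm
        · simp [step_eq_zero Γ hz]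

end Recursion

/-- On-diagonal lower bound in terms of the probability to stay in a ball. -/
theorem sq_stayProb_div_vol_le {Γ : WeightedGraph V} (hp : Γ.UniformTrans) (x : V) (R : ℝ)
    (k : ℕ) : (Γ.stayProb k x (Γ.ball x R)).toReal ^ 2 / Γ.vol x R ≤
      (Γ.stepProb (2 * k) x x).toReal / Γ.mass x := by
  have := countable_vertices hp
  have hfin : ∀ m y z, Γ.stepProb m y z ≠ ∞ := fun m y z =>
    ((Γ.stepProb_le_one m y z).trans_lt ENNReal.one_lt_top).ne
  set B := (finite_ball hp x R).toFinset with hB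
  have h1 : (Γ.stayProb k x (Γ.ball x R)).toReal ≤ ∑ z ∈ B, (Γ.stepProb k x z).toReal := by
    rw [← ENNReal.toReal_sum fun z _ => hfin _ _ _]
    refine ENNReal.toReal_mono (ENNReal.sum_ne_top.2 fun z _ => hfin _ _ _) ?_
    refine (measure_mono fun ω hω => ?_).trans
      (measure_biUnion_finset_le B fun z => {ω : ℕ → V | ω k = z})
    simp only [Set.mem_iUnion]
    exact ⟨ω k, by simpa [hB] using hω k le_rfl, rfl⟩
  have hmass : 0 ≤ Γ.vol x R := by
    rw [vol_eq_sum hp]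
    exact Finset.sum_nonneg fun y _ => (Γ.mass_pos y).le
  calc (Γ.stayProb k x (Γ.ball x R)).toReal ^ 2 / Γ.vol x R
      ≤ (∑ z ∈ B, (Γ.stepProb k x z).toReal) ^ 2 / Γ.vol x R := by gcongr
    -- Cauchy-Schwarz with weights `μ(z)`; reversibility then turns the terms into two-way trips
    -- through `z`.
    _ ≤ ∑ z ∈ B, (Γ.stepProb k x z).toReal ^ 2 / Γ.mass z := by
        rw [vol_eq_sum hp]
        exact Finset.sq_sum_div_le_sum_sq_div _ _ fun z _ => Γ.mass_pos z
    _ = (∑ z ∈ B, (Γ.stepProb k x z * Γ.stepProb k z x).toReal) / Γ.mass x := by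
        rw [Finset.sum_div]
        refine Finset.sum_congr rfl fun z _ => ?_
        have := congrArg ENNReal.toReal (Γ.ofReal_mass_mul_stepProb k x z)
        rw [ENNReal.toReal_mul, ENNReal.toReal_mul, ENNReal.toReal_ofReal (Γ.mass_pos x).le,
          ENNReal.toReal_ofReal (Γ.mass_pos z).le] at this
        rw [ENNReal.toReal_mul, div_eq_div_iff (Γ.mass_pos z).ne' (Γ.mass_pos x).ne']
        linear_combination (Γ.stepProb k x z).toReal * this
    _ ≤ _ := by
        gcongr
        · exact (Γ.mass_pos x).le
        · rw [← ENNReal.toReal_sum fun z _ => ENNReal.mul_ne_top (hfin _ _ _) (hfin _ _ _)]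
          refine ENNReal.toReal_mono (hfin _ _ _) ?_
          rw [two_mul, stepProb_add]
          exact ENNReal.sum_le_tsum _

/-! ### Finiteness of the mean exit times -/

theorem stayProb_add_le [Countable V] (Γ : WeightedGraph V) {A : Set V} {L : ℕ} {q : ℝ≥0∞}
    (hq : ∀ y, Γ.stayProb L y A ≤ q) (n : ℕ) (y : V) :
    Γ.stayProb (n + L) y A ≤ Γ.stayProb n y A * q := by
  by_cases hy : y ∈ A
  swap
  · simp [stayProb_of_notMem Γ _ hy]
  induction n generalizing y with
  | zero => simpa [stayProb_zero Γ hy] using hq y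
  | succ n ih =>
    rw [add_right_comm, stayProb_succ Γ _ hy, stayProb_succ Γ _ hy, ← ENNReal.tsum_mul_right]
    refine ENNReal.tsum_le_tsum fun z => ?_
    rw [mul_assoc]
    gcongr
    by_cases hz : z ∈ A
    · exact ih z hz
    · simp [stayProb_of_notMem Γ _ hz]

theorem meanExit_ne_top [Countable V] (Γ : WeightedGraph V) {A : Set V} {L : ℕ} {q : ℝ≥0∞}
    (hq1 : q < 1) (hq : ∀ y, Γ.stayProb L y A ≤ q) (y : V) : Γ.meanExit y A ≠ ∞ := by
  have hfin : ∀ k, Γ.stayProb k y A ≠ ∞ := fun k =>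
    ((Γ.stayProb_le_one k y A).trans_lt ENNReal.one_lt_top).ne
  have hqt : q ≠ ∞ := (hq1.trans ENNReal.one_lt_top).ne
  have hq' : q.toReal < 1 := by
    simpa using (ENNReal.toReal_lt_toReal hqt ENNReal.one_ne_top).2 hq1
  have key : ∀ n, ∑ k ∈ Finset.range n, Γ.stayProb k y A ≤
      ENNReal.ofReal (L / (1 - q.toReal)) := by
    intro n
    set S := ∑ k ∈ Finset.range n, Γ.stayProb k y A with hS
    have hSfin : S ≠ ∞ := ENNReal.sum_ne_top.2 fun k _ => hfin k
    -- Survival decays by a factor `q` every `L` steps. Since the partial sum `S` is finite, the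
    -- inequality can be solved for it.
    have h : S ≤ L + S * q := by
      calc S ≤ ∑ k ∈ Finset.range (L + n), Γ.stayProb k y A :=
            Finset.sum_le_sum_of_subset (Finset.range_mono (by omega))
        _ = ∑ k ∈ Finset.range L, Γ.stayProb k y A +
            ∑ k ∈ Finset.range n, Γ.stayProb (k + L) y A := by
            rw [Finset.sum_range_add]
            simp only [add_comm L]
        _ ≤ ∑ k ∈ Finset.range L, 1 + ∑ k ∈ Finset.range n, Γ.stayProb k y A * q := by
            gcongr
            · exact Γ.stayProb_le_one _ _ _
            · exact Γ.stayProb_add_le hq _ _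
        _ = L + S * q := by simp [hS, Finset.sum_mul]
    have h' := ENNReal.toReal_mono (by finiteness) h
    rw [ENNReal.toReal_add (by simp) (by finiteness), ENNReal.toReal_mul,
      ENNReal.toReal_natCast] at h'
    rw [← ENNReal.ofReal_toReal hSfin]
    refine ENNReal.ofReal_le_ofReal ?_
    rw [le_div_iff₀ (by linarith)]
    linarith
  rw [meanExit_eq_tsum]
  exact ((ENNReal.tsum_le_of_sum_range_le key).trans_lt ENNReal.ofReal_lt_top).ne

/-- The ball is finite and the graph infinite, so some `z` outside is reached within `L` steps with
probability at least `p ^ L` from every point of the ball. -/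
theorem exitBall_ne_top {Γ : WeightedGraph V} (hp : Γ.UniformTrans) (x : V) (R : ℝ) :
    Γ.exitBall x R ≠ ∞ := by
  have := countable_vertices hp
  have hB := finite_ball hp x R
  obtain ⟨p, hp0, hp⟩ := hp
  obtain ⟨z, hz⟩ := hB.infinite_compl.nonempty
  obtain ⟨L, hL⟩ := (hB.image fun y => Γ.graph.dist y z).bddAbove
  refine Γ.meanExit_ne_top (L := L) (q := 1 - ENNReal.ofReal p ^ L) ?_ (fun y => ?_) x
  · exact ENNReal.sub_lt_self ENNReal.one_ne_top one_ne_zero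
      (pow_ne_zero _ (by simpa using hp0))
  · by_cases hy : y ∈ Γ.ball x R
    swap
    · simp [stayProb_of_notMem Γ _ hy]
    have hd : Γ.graph.dist y z ≤ L := hL ⟨y, hy, rfl⟩
    have hp1 : ENNReal.ofReal p ≤ 1 := (Γ.le_stepProb_two hp x).trans (Γ.stepProb_le_one _ _ _)
    have h1 : ENNReal.ofReal p ^ L ≤ Γ.hitProb L y z :=
      (pow_le_pow_right_of_le_one' hp1 hd).trans (Γ.pow_dist_le_hitProb hp y z hd)
    refine ENNReal.le_sub_of_add_le_right (by finiteness) ?_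
    calc _ ≤ Γ.stayProb L y (Γ.ball x R) + Γ.hitProb L y z := by gcongr
      _ = Γ.walk y ({ω | ∀ i ≤ L, ω i ∈ Γ.ball x R} ∪ {ω | ∃ i ≤ L, ω i = z}) := by
        rw [measure_union _ (measurableSet_hit _ _)]
        · rfl
        · rw [Set.disjoint_left]
          rintro ω hω ⟨i, hi, rfl⟩
          exact hz (hω i hi)
      _ ≤ 1 := prob_le_one

/-! ### The on-diagonal lower bound -/

theorem exists_le_stepProb_diag {Γ : WeightedGraph V} (hp : Γ.UniformTrans)
    (hE : Γ.ExitCentered) : ∃ c : ℝ, 0 < c ∧ ∀ (x : V) (n k : ℕ), k ≤ n →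
      ENNReal.ofReal (c / Γ.vol x (Γ.invExit x n) * Γ.mass x) ≤
        Γ.stepProb k x x + Γ.stepProb (k + 1) x x := by
  have := countable_vertices hp
  obtain ⟨p, hp0, hpt⟩ := id hp
  obtain ⟨C, hC, hE⟩ := hE
  refine ⟨min p ((1 / (3 * C)) ^ 2), by positivity, fun x n k hk => ?_⟩
  have hR : 0 < (Γ.invExit x n : ℝ) := by exact_mod_cast (Γ.invExit_mem x n).1
  have hV : 0 < Γ.vol x (Γ.invExit x n) := (Γ.mass_pos x).trans_le (mass_le_vol hp x hR)
  have hm := Γ.mass_pos x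
  have key : ENNReal.ofReal (min p ((1 / (3 * C)) ^ 2) / Γ.vol x (Γ.invExit x n) * Γ.mass x) ≤
      Γ.stepProb (2 * ((n + 1) / 2)) x x := by
    -- The main argument needs `3j ≤ 2n` for `j = (n + 1) / 2`, which fails at `n = 1`; for `n ≤ 1`
    -- a two-step return and `V ≥ μ(x)` suffice.
    rcases le_or_gt n 1 with hn | hn
    · calc _ ≤ ENNReal.ofReal p := by
            refine ENNReal.ofReal_le_ofReal ?_
            rw [div_mul_eq_mul_div, div_le_iff₀ hV]
            have := mass_le_vol hp x hR
            gcongr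
            exact min_le_left _ _
        _ ≤ Γ.stepProb (2 * 1) x x := Γ.le_stepProb_two hpt x
        _ ≤ _ := Γ.antitone_stepProb_two_mul x (by omega)
    · set j := (n + 1) / 2
      set R : ℝ := (Γ.invExit x n : ℝ)
      have hEt := exitBall_ne_top hp x R
      have hst : Γ.stayProb j x (Γ.ball x R) ≠ ∞ :=
        ((Γ.stayProb_le_one _ _ _).trans_lt ENNReal.one_lt_top).ne
      have h1 : Γ.exitBall x R ≤ j + Γ.stayProb j x (Γ.ball x R) *
          (ENNReal.ofReal C * Γ.exitBall x R) :=
        Γ.meanExit_le_add_stayProb_mul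
          (fun z hz => (le_iSup₂ (f := fun y _ => Γ.meanExit y (Γ.ball x R)) z hz).trans
            (hE x R hR)) j x
      have h2 := ENNReal.toReal_mono (by finiteness) h1
      rw [ENNReal.toReal_add (by simp) (by finiteness), ENNReal.toReal_mul, ENNReal.toReal_mul,
        ENNReal.toReal_natCast, ENNReal.toReal_ofReal hC.le] at h2
      have h3 := ENNReal.toReal_mono hEt (Γ.invExit_mem x n).2
      rw [ENNReal.toReal_natCast] at h3
      have h4 : (3 * j : ℝ) ≤ 2 * n := by exact_mod_cast (by omega : 3 * j ≤ 2 * n)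
      have hn' : (2 : ℝ) ≤ n := by exact_mod_cast hn
      -- Writing `E` for the mean exit time, a smaller staying probability would give `E < j + E/3`,
      -- hence `E < 3j/2 ≤ n`, against `E ≥ n`.
      have h5 : 1 / (3 * C) ≤ (Γ.stayProb j x (Γ.ball x R)).toReal := by
        rw [div_le_iff₀ (by positivity)]
        by_contra! hlt
        have : 0 < (Γ.exitBall x R).toReal := by linarith
        nlinarith
      have h6 := sq_stayProb_div_vol_le hp x R j
      refine ENNReal.ofReal_le_of_le_toReal ?_
      rw [le_div_iff₀ hm] at h6
      refine le_trans ?_ h6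
      gcongr
      exact (min_le_right _ _).trans (by gcongr)
  -- One of `k` and `k + 1` is even and at most `2 * ((n + 1) / 2)`, so monotonicity along even
  -- times applies.
  rcases Nat.even_or_odd' k with ⟨i, rfl | rfl⟩
  · refine key.trans (le_trans ?_ le_self_add)
    exact Γ.antitone_stepProb_two_mul x (by omega)
  · refine key.trans (le_trans ?_ le_add_self)
    exact Γ.antitone_stepProb_two_mul x (show i + 1 ≤ (n + 1) / 2 by omega)

end WeightedGraph

end

/-! ### Hitting probabilities by chaining along geodesics -/

noncomputable section

namespace WeightedGraph

variable {V : Type*}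

theorem mem_boundary_ball (Γ : WeightedGraph V) {x z : V} (h : z ≠ x) :
    z ∈ Γ.boundary (Γ.ball x (Γ.graph.dist x z : ℕ)) := by
  refine ⟨?_, fun hz => lt_irrefl _ (show (_ : ℝ) < _ from hz)⟩
  obtain ⟨q, hq⟩ := (Γ.connected.preconnected z x).exists_walk_length_eq_dist
  cases q with
  | nil => exact absurd rfl h
  | @cons _ u _ hu q =>
    refine ⟨u, ?_, hu.symm⟩
    have h1 : Γ.graph.dist u x ≤ q.length := SimpleGraph.dist_le q
    rw [SimpleGraph.Walk.length_cons, SimpleGraph.dist_comm (u := z)] at hq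
    change (Γ.graph.dist x u : ℝ) < Γ.graph.dist x z
    rw [SimpleGraph.dist_comm (u := x) (v := u)]
    exact_mod_cast (by omega : Γ.graph.dist u x < Γ.graph.dist x z)

variable [Infinite V] [MeasurableSpace V] [DiscreteMeasurableSpace V]

/-- If `w` is not hit by time `s` but is hit before the exit from `A`, the exit also comes after
`s`. -/
theorem walk_hitTime_lt_exitTime_le (Γ : WeightedGraph V) (z w : V) (A : Set V) (s : ℕ) :
    Γ.walk z {ω | hitTime {w} ω < exitTime A ω} ≤ Γ.hitProb s z w + Γ.stayProb s z A := by
  refine (measure_mono fun ω hω => ?_).trans (measure_union_le _ _)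
  by_cases h : ∃ i ≤ s, ω i = w
  · exact Or.inl h
  · push Not at h
    refine Or.inr ((coe_lt_exitTime_iff A ω s).1 (lt_trans ?_ hω))
    exact (coe_lt_exitTime_iff _ ω s).2 fun i hi => by simpa using h i hi

/-- Under very strong recurrence, a vertex is hit with positive probability within a time of the
order of the mean exit time of the ball whose radius is twice the distance. -/
theorem le_hitProb_of_exitBall_le (Γ : WeightedGraph V) {c C : ℝ} (hc : 0 < c)
    (hvsr : ∀ (x : V) (r : ℕ), 1 ≤ r → ∀ w ∈ Γ.boundary (Γ.ball x r),
      c ≤ (Γ.walk w).real {ω | hitTime {x} ω < exitTime (Γ.ball x (2 * r)) ω})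
    (hE : ∀ (x : V) (R : ℝ), 0 < R → Γ.maxExitBall x R ≤ ENNReal.ofReal C * Γ.exitBall x R)
    {z w : V} (hzw : z ≠ w) {s : ℕ}
    (hs : ENNReal.ofReal C * Γ.exitBall w (2 * Γ.graph.dist w z) ≤
      (s + 1) * ENNReal.ofReal (c / 2)) :
    ENNReal.ofReal (c / 2) ≤ Γ.hitProb s z w := by
  have hd : 0 < Γ.graph.dist w z := Γ.connected.pos_dist_of_ne hzw.symm
  have hd' : (0 : ℝ) < Γ.graph.dist w z := by exact_mod_cast hd
  set B := Γ.ball w (2 * Γ.graph.dist w z) with hB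
  have hz : z ∈ B := by
    change (Γ.graph.dist w z : ℝ) < 2 * Γ.graph.dist w z
    linarith
  -- Markov's inequality at `z`, with `(Ē)` passing from the mean exit time at `z` to that at the
  -- centre `w`.
  have h1 : Γ.stayProb s z B ≤ ENNReal.ofReal (c / 2) := by
    have h2 := (Γ.succ_mul_stayProb_le s z B).trans
      ((le_iSup₂ (f := fun y _ => Γ.meanExit y B) z hz).trans
        ((hE w (2 * Γ.graph.dist w z) (by positivity)).trans hs))
    exact (ENNReal.mul_le_mul_iff_right (by simp) (by finiteness)).1 h2
  have h3 := ENNReal.ofReal_le_of_le_toReal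
    (hvsr w (Γ.graph.dist w z) hd z (Γ.mem_boundary_ball hzw))
  have h4 := h3.trans (Γ.walk_hitTime_lt_exitTime_le z w B s)
  rw [← add_halves c, ENNReal.ofReal_add (by positivity) (by positivity)] at h4
  exact (ENNReal.add_le_add_iff_right ENNReal.ofReal_ne_top).1 (h4.trans (by gcongr))

/-- Chaining along a geodesic. -/
theorem pow_le_hitProb_of_steps [Countable V] (Γ : WeightedGraph V) {x y : V}
    (q : Γ.graph.Walk x y) {r s : ℕ} {a : ℝ≥0∞} (ha : a ≤ 1)
    (h : ∀ i j, i ≤ j → j ≤ i + r → j ≤ q.length →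
      q.getVert j ≠ q.getVert i → a ≤ Γ.hitProb s (q.getVert j) (q.getVert i))
    (m k : ℕ) (hk : k ≤ m * r) (hkl : k ≤ q.length) :
    a ^ m ≤ Γ.hitProb (m * s) (q.getVert k) x := by
  induction m generalizing k with
  | zero =>
    obtain rfl : k = 0 := by omega
    simp [hitProb_self]
  | succ m ih =>
    -- Truncated subtraction makes the last piece end at `x` when `k < r`.
    have h1 : a ≤ Γ.hitProb s (q.getVert k) (q.getVert (k - r)) := by
      by_cases he : q.getVert k = q.getVert (k - r)
      · rw [← he, hitProb_self]
        exact ha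
      · exact h _ _ (by omega) (by omega) hkl he
    have h2 := ih (k - r) (by rw [Nat.succ_mul] at hk; omega) (by omega)
    rw [pow_succ', Nat.succ_mul, add_comm (m * s)]
    exact (mul_le_mul' h1 h2).trans (Γ.hitProb_mul_hitProb_le _ _ _ _ _)

theorem pow_le_hitProb_of_mem_chainSet [Countable V] (Γ : WeightedGraph V) {c C Q : ℝ}
    (hc : 0 < c) (hc1 : c / 2 ≤ 1) (hCQ : C ≤ c * Q)
    (hvsr : ∀ (x : V) (r : ℕ), 1 ≤ r → ∀ w ∈ Γ.boundary (Γ.ball x r),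
      c ≤ (Γ.walk w).real {ω | hitTime {x} ω < exitTime (Γ.ball x (2 * r)) ω})
    (hE : ∀ (x : V) (R : ℝ), 0 < R → Γ.maxExitBall x R ≤ ENNReal.ofReal C * Γ.exitBall x R)
    {x y : V} {n l : ℕ}
    (hl : l ∈ Γ.chainSet Q 9 x y ((n : ℝ) / 2) (Γ.graph.dist x y))
    (hld : l ≤ Γ.graph.dist x y) :
    ENNReal.ofReal (c / 2) ^ l ≤ Γ.hitProb n y x := by
  obtain ⟨hl1, hl⟩ := hl
  obtain ⟨q, hq⟩ := (Γ.connected.preconnected x y).exists_walk_length_eq_dist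
  set d := Γ.graph.dist x y with hd
  have hl0 : (0 : ℝ) < l := by exact_mod_cast hl1
  -- Since `l ≤ d`, rounding up costs at most `d / l`, so even `4 * d / l` would do.
  have hr : 2 * ((d / l + 1 : ℕ) : ℝ) ≤ 9 * d / l := by
    have h1 : ((d / l : ℕ) : ℝ) ≤ d / l := Nat.cast_div_le
    have h2 : (1 : ℝ) ≤ d / l := by
      rw [le_div_iff₀ hl0, one_mul]
      exact_mod_cast hld
    push_cast
    rw [mul_div_assoc]
    linarith
  have hs : (n : ℝ) / l ≤ ((n / l : ℕ) : ℝ) + 1 := by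
    rw [div_le_iff₀ hl0]
    have : n ≤ (n / l + 1) * l := by
      have := Nat.lt_div_mul_add (a := n) hl1
      rw [Nat.succ_mul]
      exact this.le
    exact_mod_cast this
  have key : ∀ i j, i ≤ j → j ≤ i + (d / l + 1) → j ≤ q.length →
      q.getVert j ≠ q.getVert i →
      ENNReal.ofReal (c / 2) ≤ Γ.hitProb (n / l) (q.getVert j) (q.getVert i) := by
    intro i j hij hjr hjl hne
    refine Γ.le_hitProb_of_exitBall_le hc hvsr hE hne ?_
    have hdist : Γ.graph.dist (q.getVert i) (q.getVert j) ≤ d / l + 1 := by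
      have h1 := SimpleGraph.dist_le ((q.drop i).take (j - i))
      rw [SimpleGraph.Walk.take_length, SimpleGraph.Walk.drop_getVert, Nat.add_sub_cancel' hij] at h1
      exact h1.trans (by omega)
    have hmem : q.getVert i ∈ Γ.geodesics x y := ⟨q, hq, q.getVert_mem_support i⟩
    calc ENNReal.ofReal C * Γ.exitBall (q.getVert i)
          (2 * Γ.graph.dist (q.getVert i) (q.getVert j))
        ≤ ENNReal.ofReal (c * Q) * Γ.exitBall (q.getVert i) (9 * d / l) := by
          gcongr
          refine Γ.exitBall_mono _ (le_trans ?_ hr)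
          gcongr
      _ ≤ ENNReal.ofReal c * (ENNReal.ofReal Q *
            ⨆ z ∈ Γ.geodesics x y, Γ.exitBall z (9 * d / l)) := by
          rw [ENNReal.ofReal_mul hc.le, mul_assoc]
          gcongr
          exact le_iSup₂ (f := fun z _ => Γ.exitBall z (9 * d / l)) _ hmem
      _ ≤ ENNReal.ofReal c * ENNReal.ofReal ((n : ℝ) / 2 / l) := by gcongr
      _ = ENNReal.ofReal (c * ((n : ℝ) / 2 / l)) := (ENNReal.ofReal_mul hc.le).symm
      _ ≤ ENNReal.ofReal ((((n / l : ℕ) : ℝ) + 1) * (c / 2)) := by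
          refine ENNReal.ofReal_le_ofReal ?_
          -- The halved time `t = n / 2` supplies the factor `1/2` in `c / 2`.
          calc c * ((n : ℝ) / 2 / l) = n / l * (c / 2) := by ring
            _ ≤ _ := by gcongr
      _ = (((n / l : ℕ) : ℝ≥0∞) + 1) * ENNReal.ofReal (c / 2) := by
          rw [ENNReal.ofReal_mul (by positivity), ENNReal.ofReal_add (by positivity) zero_le_one]
          simp
  have := Γ.pow_le_hitProb_of_steps q (by simpa using hc1) key l q.length
    (by
      rw [hq]
      have := Nat.lt_div_mul_add (a := d) hl1
      rw [mul_add, mul_one, mul_comm]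
      exact this.le) le_rfl
  rw [SimpleGraph.Walk.getVert_length] at this
  exact this.trans (Γ.hitProb_mono (Nat.mul_div_le n l) _ _)

/-- A single base `δ` below both `p` and `c / 2` serves chaining and the edge-by-edge route alike.
-/
theorem pow_chainNumber_le_hitProb [Countable V] (Γ : WeightedGraph V) {p c C Q δ : ℝ}
    (hp : ∀ x y, Γ.graph.Adj x y → p ≤ Γ.trans x y)
    (hc : 0 < c) (hCQ : C ≤ c * Q) (hδ1 : δ ≤ 1) (hδp : δ ≤ p) (hδc : δ ≤ c / 2) (hc1 : c / 2 ≤ 1)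
    (hvsr : ∀ (x : V) (r : ℕ), 1 ≤ r → ∀ w ∈ Γ.boundary (Γ.ball x r),
      c ≤ (Γ.walk w).real {ω | hitTime {x} ω < exitTime (Γ.ball x (2 * r)) ω})
    (hE : ∀ (x : V) (R : ℝ), 0 < R → Γ.maxExitBall x R ≤ ENNReal.ofReal C * Γ.exitBall x R)
    {x y : V} {n : ℕ} (hn : Γ.graph.dist x y ≤ n) :
    ENNReal.ofReal δ ^ Γ.chainNumber Q 9 x y ((n : ℝ) / 2) (Γ.graph.dist x y) ≤
      Γ.hitProb n y x := by
  have hfar : ∀ l, Γ.graph.dist x y ≤ l → ENNReal.ofReal δ ^ l ≤ Γ.hitProb n y x := by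
    intro l hl
    rw [SimpleGraph.dist_comm] at hl hn
    calc ENNReal.ofReal δ ^ l ≤ ENNReal.ofReal δ ^ Γ.graph.dist y x :=
          pow_le_pow_right_of_le_one' (by simpa using hδ1) hl
      _ ≤ ENNReal.ofReal p ^ Γ.graph.dist y x := by gcongr
      _ ≤ _ := Γ.pow_dist_le_hitProb hp y x hn
  unfold chainNumber
  split_ifs with h
  · rcases le_total (Γ.graph.dist x y)
      (sInf (Γ.chainSet Q 9 x y ((n : ℝ) / 2) (Γ.graph.dist x y))) with hl | hl
    · exact hfar _ hl
    · refine le_trans ?_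
        (Γ.pow_le_hitProb_of_mem_chainSet hc hc1 hCQ hvsr hE (Nat.sInf_mem h) hl)
      gcongr
  · exact hfar _ le_rfl

theorem heat_eq [Countable V] (Γ : WeightedGraph V) (n : ℕ) (x y : V) :
    Γ.heat n x y = (Γ.stepProb n y x).toReal / Γ.mass x := by
  have := congrArg ENNReal.toReal (Γ.ofReal_mass_mul_stepProb n x y)
  rw [ENNReal.toReal_mul, ENNReal.toReal_mul, ENNReal.toReal_ofReal (Γ.mass_pos x).le,
    ENNReal.toReal_ofReal (Γ.mass_pos y).le] at this
  change (Γ.stepProb n x y).toReal / Γ.mass y = _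
  rw [div_eq_div_iff (Γ.mass_pos y).ne' (Γ.mass_pos x).ne']
  linarith

end WeightedGraph

end

/-! ### The off-diagonal lower bound -/

theorem theorem4p1 {V : Type*} [Infinite V] [MeasurableSpace V] [DiscreteMeasurableSpace V]
    (Γ : WeightedGraph V) (hp : Γ.UniformTrans) (hvsr : Γ.VeryStronglyRecurrent)
    (hE : Γ.ExitCentered) :
    ∃ Q₀ : ℝ, 0 < Q₀ ∧ ∀ Q : ℝ, Q₀ ≤ Q → ∃ c C : ℝ, 0 < c ∧ 0 < C ∧
      ∀ (x y : V) (n : ℕ), Γ.graph.dist x y ≤ n →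
        c / Γ.vol x (Γ.invExit x n) *
            Real.exp (-C * Γ.chainNumber Q 9 x y ((n : ℝ) / 2) (Γ.graph.dist x y))
          ≤ Γ.heatTilde n x y := by
  have := WeightedGraph.countable_vertices hp
  obtain ⟨c₁, hc₁, hdiag⟩ := WeightedGraph.exists_le_stepProb_diag hp hE
  obtain ⟨p, hp0, hpt⟩ := id hp
  obtain ⟨c, hc, hvsr⟩ := hvsr
  obtain ⟨C, hC, hE⟩ := hE
  -- `c` bounds a probability from below, provided some boundary point exists; any `z ≠ x` gives
  -- one.
  have hc1 : c ≤ 1 := by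
    obtain ⟨x⟩ : Nonempty V := inferInstance
    obtain ⟨z, hz⟩ := exists_ne x
    exact (hvsr x _ (Γ.connected.pos_dist_of_ne hz.symm) z (Γ.mem_boundary_ball hz)).trans
      measureReal_le_one
  -- `Q ≥ C / c` is exactly what absorbs the constant of `(Ē)` in each chaining step.
  refine ⟨C / c, by positivity, fun Q hQ => ?_⟩
  set δ := min p (c / 2) with hδ
  have hδ0 : 0 < δ := by positivity
  have hδc : δ ≤ c / 2 := min_le_right _ _
  refine ⟨c₁, -Real.log δ, hc₁, neg_pos.2 (Real.log_neg hδ0 (by linarith)),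
    fun x y n hn => ?_⟩
  set l := Γ.chainNumber Q 9 x y ((n : ℝ) / 2) (Γ.graph.dist x y)
  have hhit : ENNReal.ofReal δ ^ l ≤ Γ.hitProb n y x :=
    Γ.pow_chainNumber_le_hitProb hpt hc (by rwa [div_le_iff₀' hc] at hQ) (by linarith)
      (min_le_left _ _) hδc (by linarith) hvsr hE hn
  have hexp : Real.exp (- -Real.log δ * l) = δ ^ l := by
    rw [neg_neg, mul_comm, Real.exp_nat_mul, Real.exp_log hδ0]
  have hm := Γ.mass_pos x
  have hV : 0 < Γ.vol x (Γ.invExit x n) :=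
    hm.trans_le (WeightedGraph.mass_le_vol hp x (by exact_mod_cast (Γ.invExit_mem x n).1))
  have hfin : ∀ m, Γ.stepProb m y x ≠ ∞ := fun m =>
    ((Γ.stepProb_le_one m y x).trans_lt ENNReal.one_lt_top).ne
  have key := (mul_le_mul' hhit le_rfl).trans
    (Γ.hitProb_mul_le_stepProb x n (fun k hk => hdiag x n k hk) y)
  have key' := ENNReal.toReal_mono (ENNReal.add_ne_top.2 ⟨hfin _, hfin _⟩) key
  rw [ENNReal.toReal_mul, ENNReal.toReal_pow, ENNReal.toReal_ofReal hδ0.le,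
    ENNReal.toReal_ofReal (by positivity), ENNReal.toReal_add (hfin _) (hfin _)] at key'
  rw [hexp, WeightedGraph.heatTilde, WeightedGraph.heat_eq, WeightedGraph.heat_eq, ← add_div,
    le_div_iff₀ hm]
  calc _ = δ ^ l * (c₁ / Γ.vol x (Γ.invExit x n) * Γ.mass x) := by ring
    _ ≤ _ := key'
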